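/- Fix an infinite set of variables. Literals are variables $v$ and their complements $\overline{v}$ (with $\overline{\overline{v}} = v$); a clause is a finite set $C$ of literals with $C \cap \overline{C} = \emptyset$, where $\overline{C} := \{\overline{x} : x \in C\}$; a clause-set is a finite set of clauses. If clauses $C, D$ satisfy $C \cap \overline{D} = \{x\}$, their resolvent is $(C \cup D) \setminus \{x, \overline{x}\}$; a prime implicate of a clause-set $F$ is a clause derivable from $F$ by a resolution tree (with all leaf clauses in $F$) such that no strict subset of it is so derivable. For $k \ge 0$ the trigger hypergraph of $F$ at level $k$ has as vertices the prime implicates of $F$, and as hyperedges the sets $$E^k_C := \{ C' \text{ a prime implicate of } F : C' \cap \overline{C} = \emptyset \text{ and } |C' \setminus C| \le k \}$$ for the prime implicates $C$ of $F$. The matching number $\nu(G)$ of a hypergraph $G$ is the maximum number of pairwise disjoint hyperedges. In a full binary tree every inner node has two children (left and right). The height and the Horton–Strahler number of the one-node tree are $0$. If $T$ has the two subtrees $T_1, T_2$ at its root, then the height of $T$ is $1$ plus the maximum of the heights of $T_1, T_2$, and the Horton–Strahler number of $T$ is the maximum of those of $T_1, T_2$ if these differ, and $1$ plus their common value otherwise.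 An extremal tree of Horton–Strahler number $k'$ and height $h$ is a full binary tree with exactly these parameters which has the maximum number of nodes among all full binary trees of Horton–Strahler number at most $k'$ and height at most $h$. For a full binary tree $T$ whose inner nodes are labelled injectively by variables, label the edge from an inner node with label $v$ to its left child by the literal $v$, and to its right child by $\overline{v}$; then $\mathrm{smuo}(T)$ is the set of clauses $C_w$, for the leaves $w$ of $T$, where $C_w$ is the set of edge-labels on the path from the root to $w$. The doping of a clause-set $F$ is $\mathrm{doping}(F) := \{C \cup \{u_C\} : C \in F\}$, where $C \mapsto u_C$ is any injection from $F$ into the variables not occurring in $F$. **Theorem 6.5.** Let $k \ge 0$. 1. Let $h \ge k+1$, let $T$ be an extremal tree of Horton–Strahler number $k+1$ and height $h$, with inner nodes labelled injectively by variables, let $F := \mathrm{doping}(\mathrm{smuo}(T))$ (for any choice of the doping variables), let $G$ be the trigger hypergraph of $F$ at level $k$, and let $m := 1 + h - k$. Then $$\nu(G) \ \ge\ \binom{m}{\lfloor m/2 \rfloor}.$$ 2. If $h \ge k+5$, then with $m := 1 + h - k$ we have $$\binom{m}{\lfloor m/2 \rfloor} \ >\ \frac{1}{\sqrt{2}} \,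 \frac{2^m}{\sqrt{m}}.$$ 3. For the fixed $k$ and $h \to \infty$, with $m := 1 + h - k$ we have $$\frac{1}{\sqrt{2}} \, \frac{2^m}{\sqrt{m}} \ =\ \Theta\!\left(\frac{2^h}{\sqrt{h}}\right).$$ -/

import Mathlib

open Filter Asymptotics

/-- Literals over a set `VA` of variables: `(v, true)` is the positive literal `v`,
`(v, false)` is the negative literal (the complement of `v`). -/
abbrev Lit (VA : Type*) := VA × Bool

namespace Lit

variable {VA : Type*}

/-- The variable `v` as a positive literal. -/
def pos (v : VA) : Lit VA := (v, true)

/-- The complemented variable `v`, as a negative literal. -/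
def neg (v : VA) : Lit VA := (v, false)

/-- The underlying variable of a literal. -/
def var (x : Lit VA) : VA := x.1

/-- The complement of a literal. -/
def compl (x : Lit VA) : Lit VA := (x.1, !x.2)

end Lit

section ClauseSets

variable {VA : Type*} [DecidableEq VA]

/-- The set of the complements of the literals in `L`. -/
def complLits (L : Finset (Lit VA)) : Finset (Lit VA) := L.image Lit.compl

/-- A finite set of literals is a clause if it is complement-free. -/
def IsClause (C : Finset (Lit VA)) : Prop := C ∩ complLits C = ∅

/-- A finite set of finite sets of literals is a clause-set if all its elements are clauses. -/
def IsClauseSet (F : Finset (Finset (Lit VA))) : Prop := ∀ C ∈ F, IsClause C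

/-- The set of variables of a clause-set. -/
def clauseSetVars (F : Finset (Finset (Lit VA))) : Finset VA :=
  F.biUnion fun C => C.image Lit.var

/-- `ResDerives F C`: there is a resolution tree with axioms (the clauses at its leaves) in `F`
and with derived clause `C` (at its root). The constructor `leaf` is the trivial tree; `node` joins
trees deriving `C` and `D`, where `C` and `D` clash in exactly one literal `x`, to a tree
deriving their resolvent. -/
inductive ResDerives (F : Finset (Finset (Lit VA))) : Finset (Lit VA) → Prop
  | leaf (C : Finset (Lit VA)) (hC : C ∈ F) : ResDerives F C
  | node (C D : Finset (Lit VA)) (x : Lit VA) (hC : ResDerives F C) (hD : ResDerives F D)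
      (hx : C ∩ complLits D = {x}) : ResDerives F ((C ∪ D) \ {x, x.compl})

/-- The set of prime implicates of `F`: the clauses derivable from `F` by resolution, such
that no strict sub-clause is derivable. -/
def primeImplicates (F : Finset (Finset (Lit VA))) : Set (Finset (Lit VA)) :=
  {C | ResDerives F C ∧ ∀ C', C' ⊂ C → ¬ ResDerives F C'}

/-- The doping of `F` with the doping variables `u C` for `C ∈ F`: the variable `u C` is added
(as a positive literal) to the clause `C`. -/
def doping (u : Finset (Lit VA) → VA) (F : Finset (Finset (Lit VA))) :
    Finset (Finset (Lit VA)) :=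
  F.image fun C => insert (Lit.pos (u C)) C

/-- `u` assigns to the clauses of `F` pairwise different variables not occurring in `F`. -/
def IsDopingAssignment (u : Finset (Lit VA) → VA) (F : Finset (Finset (Lit VA))) : Prop :=
  Set.InjOn u (F : Set (Finset (Lit VA))) ∧ ∀ C ∈ F, u C ∉ clauseSetVars F

/-- The hyperedge of the trigger hypergraph of `F` at level `k` given by `C`: all prime implicates
`C'` of `F` which do not clash with `C`, and which have at most `k` literals not in `C`. -/
def triggerEdge (F : Finset (Finset (Lit VA))) (k : ℕ) (C : Finset (Lit VA)) :
    Set (Finset (Lit VA)) :=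
  {C' | C' ∈ primeImplicates F ∧ C' ∩ complLits C = ∅ ∧ (C' \ C).card ≤ k}

/-- The trigger hypergraph of `F` at level `k`. -/
def triggerHypergraph (F : Finset (Finset (Lit VA))) (k : ℕ) :
    Hypergraph (Finset (Lit VA)) where
  vertexSet := primeImplicates F
  edgeSet := triggerEdge F k '' primeImplicates F
  subset_vertexSet_of_mem_edgeSet' := by
    rintro e ⟨C, _, rfl⟩ C' hC'
    exact hC'.1

end ClauseSets

/-- The matching number of a hypergraph: the supremum (for finite hypergraphs, the maximum) of the
numbers of elements of sets of pairwise disjoint hyperedges. -/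
noncomputable def matchingNumber {α : Type*} (H : Hypergraph α) : ℕ∞ :=
  ⨆ M ∈ {M : Set (Set α) | M ⊆ H.edgeSet ∧ M.PairwiseDisjoint id}, M.encard

/-! Full binary trees (every inner node has two children) with labelled inner nodes are given by
`BinaryTree`, where `BinaryTree.nil` is the trivial tree, that is, a leaf (which has no label). -/

/-- The Horton-Strahler number of a full binary tree. -/
def hortonStrahler {α : Type*} : BinaryTree α → ℕ
  | .nil => 0
  | .node _ l r =>
      if hortonStrahler l = hortonStrahler r then 1 + max (hortonStrahler l) (hortonStrahler r)
      else max (hortonStrahler l) (hortonStrahler r)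

/-- The number of all nodes (inner nodes and leaves) of a full binary tree. -/
def numAllNodes {α : Type*} (T : BinaryTree α) : ℕ := T.numNodes + T.numLeaves

/-- `T` (whose labels are irrelevant here) is an extremal tree of Horton-Strahler number `k` and
height `h`: it has the maximal number of nodes among all full binary trees (unlabelled, that is,
with all labels the same) of Horton-Strahler number at most `k` and height at most `h`. -/
def IsExtremalTree {α : Type*} (k h : ℕ) (T : BinaryTree α) : Prop :=
  hortonStrahler T = k ∧ T.height = h ∧
    ∀ T' : BinaryTree Unit, hortonStrahler T' ≤ k → T'.height ≤ h →
      numAllNodes T' ≤ numAllNodes T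

/-- The list of the labels of all inner nodes. -/
def innerLabels {α : Type*} : BinaryTree α → List α
  | .nil => []
  | .node v l r => v :: (innerLabels l ++ innerLabels r)

/-- The labelling of the inner nodes of `T` is injective: no label occurs twice. -/
def InjectivelyLabelled {α : Type*} (T : BinaryTree α) : Prop := (innerLabels T).Nodup

/-- The clause-set representation of a tree with inner nodes labelled by variables. The edges from
an inner node labelled `v` to its left resp. right child are labelled by the literal `v` resp.
its complement, and every leaf yields the clause of all edge-labels on the path from the root. -/
def smuOne {VA : Type*} [DecidableEq VA] : BinaryTree VA → Finset (Finset (Lit VA))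
  | .nil => {∅}
  | .node v l r =>
      (smuOne l).image (insert (Lit.pos v)) ∪ (smuOne r).image (insert (Lit.neg v))

section WellFormed

variable {VA : Type*} [DecidableEq VA]

theorem isClause_iff (C : Finset (Lit VA)) :
    IsClause C ↔ ∀ v, ¬ (Lit.pos v ∈ C ∧ Lit.neg v ∈ C) := by
  simp only [IsClause, complLits, Finset.ext_iff, Finset.mem_inter, Finset.mem_image,
    Finset.notMem_empty, iff_false, Lit.pos, Lit.neg, Lit.compl]
  constructor
  · intro h v hv
    exact h (v, true) ⟨hv.1, (v, false), hv.2, rfl⟩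
  · rintro h ⟨v, b⟩ ⟨h1, ⟨w, c⟩, h2, h3⟩
    simp only [Prod.mk.injEq] at h3
    obtain ⟨rfl, rfl⟩ := h3
    cases c
    · exact h w ⟨h1, h2⟩
    · exact h w ⟨h2, h1⟩

theorem var_mem_innerLabels (T : BinaryTree VA) (C : Finset (Lit VA)) (hC : C ∈ smuOne T)
    (x : Lit VA) (hx : x ∈ C) : x.1 ∈ innerLabels T := by
  induction T generalizing C x with
  | nil => simp_all [smuOne]
  | node v l r ihl ihr =>
    simp only [smuOne, Finset.mem_union, Finset.mem_image] at hC
    simp only [innerLabels, List.mem_cons, List.mem_append]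
    rcases hC with ⟨D, hD, rfl⟩ | ⟨D, hD, rfl⟩ <;> rcases Finset.mem_insert.1 hx with rfl | hx
    · exact Or.inl rfl
    · exact Or.inr (Or.inl (ihl D hD x hx))
    · exact Or.inl rfl
    · exact Or.inr (Or.inr (ihr D hD x hx))

/-- The clause-set representation of an injectively labelled tree is a clause-set. -/
theorem isClauseSet_smuOne (T : BinaryTree VA) (hT : InjectivelyLabelled T) :
    IsClauseSet (smuOne T) := by
  induction T with
  | nil => intro C hC; simp_all [smuOne, isClause_iff]
  | node v l r ihl ihr =>
    simp only [InjectivelyLabelled, innerLabels, List.nodup_cons, List.mem_append, not_or,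
      List.nodup_append] at hT
    intro C hC
    simp only [smuOne, Finset.mem_union, Finset.mem_image] at hC
    rw [isClause_iff]
    rintro w ⟨h1, h2⟩
    rcases hC with ⟨D, hD, rfl⟩ | ⟨D, hD, rfl⟩
    · have hD' := (isClause_iff D).1 (ihl hT.2.1 D hD) w
      have hv := var_mem_innerLabels l D hD
      simp only [Finset.mem_insert, Lit.pos, Lit.neg, Prod.mk.injEq] at h1 h2 hD'
      grind
    · have hD' := (isClause_iff D).1 (ihr hT.2.2.1 D hD) w
      have hv := var_mem_innerLabels r D hD
      simp only [Finset.mem_insert, Lit.pos, Lit.neg, Prod.mk.injEq] at h1 h2 hD'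
      grind

/-- The doping of a clause-set is a clause-set. -/
theorem isClauseSet_doping (u : Finset (Lit VA) → VA) (F : Finset (Finset (Lit VA)))
    (hF : IsClauseSet F) (hu : IsDopingAssignment u F) : IsClauseSet (doping u F) := by
  intro C hC
  obtain ⟨D, hD, rfl⟩ := Finset.mem_image.1 hC
  rw [isClause_iff]
  rintro w ⟨h1, h2⟩
  have hD' := (isClause_iff D).1 (hF D hD) w
  have hv : ∀ b, (u D, b) ∉ D := fun b hb => hu.2 D hD
    (Finset.mem_biUnion.2 ⟨D, hD, Finset.mem_image.2 ⟨_, hb, rfl⟩⟩)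
  simp only [Finset.mem_insert, Lit.pos, Lit.neg, Prod.mk.injEq] at h1 h2 hD'
  grind

end WellFormed

/-! Every nonempty set of leaves of `T` gives a prime implicate of the doping: resolve the doped
clauses of the selected leaves along the tree. `cost s t` bounds from below the number of literals
of the clause of `t` missing from that of `s`; it is `⊤` at a clash and vanishes only for `s = t`.
Every derivable clause contains the clause of some selection, so two hyperedges centred at the
clauses of `s` and `s'` can meet only if some `t` has cost at most `k` from both `s` and `s'`. It
remains to find many selections without such a `t`.

Extremality forces all nodes at depth `k` to exist, with subtrees of height at least `h - k`
(`IsExtremalTree.highAtDepth`). Each of these subtrees contains a caterpillar with `m` leaves; a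
subset of the `m` positions is used simultaneously below all nodes at depth `k`. For incomparable
subsets `p`, `q` the cost from `p` to `q` is at least `k + 2`, and no `t` is within cost `k` of
both: at a node whose halves satisfy this for `k`, a `t` within `k + 1` of both would have to agree
with `q` in one half, and that half is already too far from `p` (`exists_separated_selections`). The
subsets of size `⌊m/2⌋` are pairwise incomparable, which gives the binomial coefficient.

The numerical estimate is the squared inequality `4 ^ m < 2 * m * (m.choose (m / 2)) ^ 2`, proved by
induction for each parity of `m`. -/

/-! ### Leaf selections and their asymmetric distance. -/

/-- Nonempty sets of leaves of a full binary tree. -/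
inductive LeafSelection {α : Type*} : BinaryTree α → Type _
  | leaf : LeafSelection .nil
  | left {v : α} {l r : BinaryTree α} (s : LeafSelection l) : LeafSelection (.node v l r)
  | right {v : α} {l r : BinaryTree α} (t : LeafSelection r) : LeafSelection (.node v l r)
  | both {v : α} {l r : BinaryTree α} (s : LeafSelection l) (t : LeafSelection r) :
      LeafSelection (.node v l r)

namespace LeafSelection

/-- A selection of a single leaf. -/
def single {α : Type*} : (T : BinaryTree α) → LeafSelection T
  | .nil => leaf
  | .node _ l _ => left (single l)

/-- A lower bound for the number of literals of the prime implicate given by the second selection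
that are not in the one given by the first selection; infinite if these two clash. -/
def cost {α : Type*} : {T : BinaryTree α} → LeafSelection T → LeafSelection T → ℕ∞
  | _, .leaf, .leaf => 0
  | _, .left a, .left a' => cost a a'
  | _, .left _, .right _ => ⊤
  | _, .left a, .both a' _ => cost a a' + 1
  | _, .right _, .left _ => ⊤
  | _, .right b, .right b' => cost b b'
  | _, .right b, .both _ b' => cost b b' + 1
  | _, .both a _, .left a' => cost a a' + 1
  | _, .both _ b, .right b' => cost b b' + 1
  | _, .both a b, .both a' b' => cost a a' + cost b b'

/-- Any two different constructors at the same node contribute at least 1. Both primality of the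
selection clauses and the level `k = 0` rest on this. -/
theorem eq_of_cost_eq_zero {α : Type*} {T : BinaryTree α} (s t : LeafSelection T)
    (h : cost s t = 0) : s = t := by
  induction s with
  | leaf => cases t; rfl
  | left s ih =>
    rcases t with _ | t | t | ⟨t, t'⟩ <;> simp only [cost, ENat.top_ne_zero, add_eq_zero] at h
    · rw [ih t h]
    · simp at h
  | right s ih =>
    rcases t with _ | t | t | ⟨t, t'⟩ <;> simp only [cost, ENat.top_ne_zero, add_eq_zero] at h
    · rw [ih t h]
    · simp at h
  | both s s' ih ih' =>
    rcases t with _ | t | t | ⟨t, t'⟩ <;> simp only [cost, add_eq_zero] at h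
    · simp at h
    · simp at h
    · rw [ih t h.1, ih' t' h.2]

theorem one_le_cost {α : Type*} {T : BinaryTree α} {s t : LeafSelection T} (h : s ≠ t) :
    1 ≤ cost s t :=
  Order.one_le_iff_ne_zero.2 fun h0 => h (eq_of_cost_eq_zero s t h0)

end LeafSelection

/-! ### Separated families of selections -/

/-- All nodes at depth `k` exist, and the subtrees there have height at least `n`. -/
def HighAtDepth {α : Type*} (n : ℕ) : ℕ → BinaryTree α → Prop
  | 0, T => n ≤ T.height
  | _ + 1, .nil => False
  | k + 1, .node _ l r => HighAtDepth n k l ∧ HighAtDepth n k r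

/-- Two subsets of `{0, ..., n}` are incomparable, and the smallest element in which they differ
belongs to the first one. -/
def LexIncomparable (n : ℕ) (p q : ℕ → Bool) : Prop :=
  (∃ i ≤ n, (∀ j < i, p j = q j) ∧ p i = true ∧ q i = false) ∧
    ∃ j ≤ n, q j = true ∧ p j = false

theorem LexIncomparable.tail {n : ℕ} {p q : ℕ → Bool} (h : LexIncomparable (n + 1) p q)
    (h0 : p 0 = q 0) : LexIncomparable n (fun i => p (i + 1)) (fun i => q (i + 1)) := by
  obtain ⟨⟨i, hi, hlt, hpi, hqi⟩, j, hj, hqj, hpj⟩ := h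
  rcases i with _ | i
  · simp_all
  rcases j with _ | j
  · simp_all
  exact ⟨⟨i, by omega, fun a ha => hlt (a + 1) (by omega), hpi, hqi⟩, j, by omega, hqj, hpj⟩

theorem LexIncomparable.head {n : ℕ} {p q : ℕ → Bool} (h : LexIncomparable n p q)
    (h0 : p 0 ≠ q 0) : p 0 = true ∧ q 0 = false := by
  obtain ⟨⟨i, hi, hlt, hpi, hqi⟩, -⟩ := h
  rcases i with _ | i
  · exact ⟨hpi, hqi⟩
  · exact absurd (hlt 0 (by omega)) h0

/-- The least differing element decides the orientation. One orientation suffices, since having no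
common close selection is symmetric in `p` and `q`. -/
theorem lexIncomparable_or {n : ℕ} {p q : ℕ → Bool} (h1 : ∃ j ≤ n, p j = true ∧ q j = false)
    (h2 : ∃ j ≤ n, q j = true ∧ p j = false) :
    LexIncomparable n p q ∨ LexIncomparable n q p := by
  classical
  have hex : ∃ i, p i ≠ q i := by obtain ⟨j, -, a, b⟩ := h1; exact ⟨j, by simp [a, b]⟩
  have hspec := Nat.find_spec hex
  have hmin : ∀ j < Nat.find hex, p j = q j := fun j hj => by
    simpa using Nat.find_min hex hj
  have hle : Nat.find hex ≤ n := by
    obtain ⟨j, hj, a, b⟩ := h1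
    exact (Nat.find_min' hex (by simp [a, b])).trans hj
  cases hp : p (Nat.find hex) <;> cases hq : q (Nat.find hex)
  · simp_all
  · exact Or.inr ⟨⟨_, hle, fun j hj => (hmin j hj).symm, hq, hp⟩, h1⟩
  · exact Or.inl ⟨⟨_, hle, hmin, hp, hq⟩, h2⟩
  · simp_all

open LeafSelection in
/-- The selections given by the nonempty subsets of the leaves of a caterpillar which is an upper
part of the tree. -/
theorem exists_caterpillar_selections {α : Type*} (n : ℕ) (T : BinaryTree α)
    (hT : n ≤ T.height) : ∃ F : (ℕ → Bool) → LeafSelection T,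
      (∀ p q : ℕ → Bool, (∃ i ≤ n, p i = true) → (∃ i ≤ n, q i = true) →
        (∃ i ≤ n, p i ≠ q i) → F p ≠ F q) ∧
      ∀ p q : ℕ → Bool, LexIncomparable n p q → 2 ≤ cost (F p) (F q) := by
  classical
  induction n generalizing T with
  | zero =>
    -- The caterpillar is a single position: sets containing `0` cannot differ on `{0}`, and no two
    -- sets are incomparable there.
    refine ⟨fun _ => single T, fun p q ⟨i, hi, hpi⟩ ⟨j, hj, hqj⟩ ⟨a, ha, hne⟩ => ?_,
      fun p q ⟨⟨i, hi, _, hpi, hqi⟩, j, hj, hqj, hpj⟩ => ?_⟩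
    · obtain rfl := Nat.le_zero.1 hi
      obtain rfl := Nat.le_zero.1 hj
      obtain rfl := Nat.le_zero.1 ha
      exact absurd (hpi.trans hqj.symm) hne
    · obtain rfl := Nat.le_zero.1 hi
      obtain rfl := Nat.le_zero.1 hj
      simp_all
  | succ n ih =>
    obtain _ | ⟨v, l, r⟩ := T
    · simp [BinaryTree.height] at hT
    -- The caterpillar continues into a child `c` that is high enough, with one leaf attached on the
    -- other side. `deep` selects only inside `c`, `full` adds the attached leaf, `side` is that
    -- leaf alone; this treats both choices of `c` at once.
    suffices H : ∀ (c : BinaryTree α), n ≤ c.height →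
        ∀ (deep full : LeafSelection c → LeafSelection (.node v l r))
          (side : LeafSelection (.node v l r)),
        (∀ a b, cost (deep a) (deep b) = cost a b) → (∀ a b, cost a b ≤ cost (full a) (full b)) →
        (∀ a b, cost (full a) (deep b) = cost a b + 1) → (∀ b, cost side (deep b) = ⊤) →
        (∀ a, deep a ≠ side) → (∀ a, full a ≠ side) → (∀ a b, full a ≠ deep b) →
        deep.Injective → full.Injective →
        ∃ F : (ℕ → Bool) → LeafSelection (.node v l r),
        (∀ p q : ℕ → Bool, (∃ i ≤ n + 1, p i = true) → (∃ i ≤ n + 1, q i = true) →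
          (∃ i ≤ n + 1, p i ≠ q i) → F p ≠ F q) ∧
        ∀ p q : ℕ → Bool, LexIncomparable (n + 1) p q → 2 ≤ cost (F p) (F q) by
      have h' : n ≤ l.height ∨ n ≤ r.height := by
        simp only [BinaryTree.height] at hT
        omega
      rcases h' with h' | h'
      · exact H l h' left (both · (single r)) (right (single r)) (by simp [cost])
          (by simp [cost]) (by simp [cost]) (by simp [cost]) (by simp) (by simp) (by simp)
          (fun a b => by simp) (fun a b => by simp)
      · exact H r h' right (both (single l) ·) (left (single l)) (by simp [cost])
          (by simp [cost]) (by simp [cost]) (by simp [cost]) (by simp) (by simp) (by simp)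
          (fun a b => by simp) (fun a b => by simp)
    intro c hc deep full side hdd hff hfd hsd hds hfs hfd' hdi hfi
    obtain ⟨G, hG1, hG2⟩ := ih c hc
    have split : ∀ p : ℕ → Bool, (∃ i ≤ n + 1, p i = true) ↔
        p 0 = true ∨ ∃ i ≤ n, p (i + 1) = true := by
      intro p
      constructor
      · rintro ⟨_ | i, hi, h⟩
        · exact Or.inl h
        · exact Or.inr ⟨i, by omega, h⟩
      · rintro (h | ⟨i, hi, h⟩)
        · exact ⟨0, by omega, h⟩
        · exact ⟨i + 1, by omega, h⟩
    -- Position `0` is the attached leaf, position `i + 1` is position `i` in `c`. The empty set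
    -- also gets `side`, a harmless default as both claims concern nonempty sets only.
    refine ⟨fun p => if ∃ i ≤ n, p (i + 1) = true then
      (if p 0 = true then full (G fun i => p (i + 1)) else deep (G fun i => p (i + 1)))
      else side, ?_, ?_⟩
    · intro p q hp hq hpq
      rw [split] at hp hq
      have key : (∃ i ≤ n, p (i + 1) = true) → (∃ i ≤ n, q (i + 1) = true) → p 0 = q 0 →
          (G fun i => p (i + 1)) ≠ G fun i => q (i + 1) := by
        intro hp' hq' h0
        refine hG1 _ _ hp' hq' ?_
        obtain ⟨_ | i, hi, h⟩ := hpq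
        · exact absurd h0 h
        · exact ⟨i, by omega, h⟩
      dsimp only
      split_ifs with h1 h2 h3 h4 h5 h6 h7 h8
      · exact fun h => key h1 h3 (by rw [h2, h4]) (hfi h)
      · exact hfd' _ _
      · exact hfs _
      · exact (hfd' _ _).symm
      · exact fun h => key h1 h5 (by grind) (hdi h)
      · exact hds _
      · exact (hfs _).symm
      · exact (hds _).symm
      · have hq1 : ¬∃ i ≤ n, q (i + 1) = true := by assumption
        obtain ⟨_ | i, hi, h⟩ := hpq
        · exact absurd ((hp.resolve_right h1).trans (hq.resolve_right hq1).symm) h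
        · have a1 : p (i + 1) = false := by
            by_contra h'
            exact h1 ⟨i, by omega, by simpa using h'⟩
          have a2 : q (i + 1) = false := by
            by_contra h'
            exact hq1 ⟨i, by omega, by simpa using h'⟩
          exact absurd (a1.trans a2.symm) h
    · intro p q h
      by_cases h0 : p 0 = q 0
      · have ht := h.tail h0
        have hp : ∃ i ≤ n, p (i + 1) = true := by
          obtain ⟨⟨i, hi, _, h, _⟩, _⟩ := ht
          exact ⟨i, hi, h⟩
        have hq : ∃ i ≤ n, q (i + 1) = true := by
          obtain ⟨_, i, hi, h, _⟩ := ht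
          exact ⟨i, hi, h⟩
        dsimp only
        rw [if_pos hp, if_pos hq, h0]
        split_ifs
        · exact (hG2 _ _ ht).trans (hff _ _)
        · rw [hdd]
          exact hG2 _ _ ht
      · obtain ⟨hp0, hq0⟩ := h.head h0
        -- Here `p` has the attached leaf and `q` does not, so `q` has an element in `c` missing
        -- from `p`. If `p` also enters `c`, the cost is 1 plus that of two different selections;
        -- otherwise there is a clash.
        obtain ⟨-, _ | j, hj, hqj, hpj⟩ := h
        · simp_all
        have hq : ∃ i ≤ n, q (i + 1) = true := ⟨j, by omega, hqj⟩
        dsimp only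
        have hq0' : ¬q 0 = true := by simp [hq0]
        rw [if_pos hq, if_pos hp0, if_neg hq0']
        split_ifs with hp
        · rw [hfd]
          have := one_le_cost (hG1 _ _ hp hq ⟨j, by omega, by simp [hqj, hpj]⟩)
          calc (2 : ℕ∞) = 1 + 1 := by norm_num
            _ ≤ _ := by gcongr
        · simp [hsd]

open LeafSelection in
/-- If the subtrees at depth `k` have height at least `n`, then the incomparable subsets of
`{0, ..., n}` yield selections without a common selection of cost at most `k`. -/
theorem exists_separated_selections {α : Type*} (n k : ℕ) (T : BinaryTree α)
    (hT : HighAtDepth n k T) : ∃ F : (ℕ → Bool) → LeafSelection T,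
      (∀ p q : ℕ → Bool, LexIncomparable n p q →
        ∀ t, cost (F p) t ≤ k → cost (F q) t ≤ k → False) ∧
      ∀ p q : ℕ → Bool, LexIncomparable n p q → (k : ℕ∞) + 2 ≤ cost (F p) (F q) := by
  induction k generalizing T with
  | zero =>
    obtain ⟨F, h1, h2⟩ := exists_caterpillar_selections n T hT
    refine ⟨F, fun p q h t hp hq => ?_, fun p q h => by simpa using h2 p q h⟩
    have e1 := eq_of_cost_eq_zero _ _ (nonpos_iff_eq_zero.1 (by simpa using hp))
    have e2 := eq_of_cost_eq_zero _ _ (nonpos_iff_eq_zero.1 (by simpa using hq))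
    obtain ⟨⟨i, hi, _, hpi, hqi⟩, j, hj, hqj, hpj⟩ := h
    exact h1 p q ⟨i, hi, hpi⟩ ⟨j, hj, hqj⟩ ⟨i, hi, by simp [hpi, hqi]⟩ (e1.trans e2.symm)
  | succ k ih =>
    obtain _ | ⟨v, l, r⟩ := T
    · exact hT.elim
    obtain ⟨A, hA1, hA2⟩ := ih l hT.1
    obtain ⟨B, hB1, hB2⟩ := ih r hT.2
    refine ⟨fun p => both (A p) (B p), fun p q h t hp hq => ?_, fun p q h => ?_⟩
    -- If `t` omits one half, that alone costs 1, and the induction hypothesis applies in the other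
    -- half.
    · have cancel : ∀ c : ℕ∞, c + 1 ≤ ((k + 1 : ℕ) : ℕ∞) → c ≤ k := fun c hc => by
        push_cast at hc
        exact (ENat.add_le_add_iff_right (by simp)).1 hc
      rcases t with _ | a | b | ⟨a, b⟩
      · simp only [cost] at hp hq
        exact hA1 p q h a (cancel _ hp) (cancel _ hq)
      · simp only [cost] at hp hq
        exact hB1 p q h b (cancel _ hp) (cancel _ hq)
      · simp only [cost] at hp hq
        have a1 := hA1 p q h a
        have b1 := hB1 p q h b
        have a2 := hA2 p q h
        have b2 := hB2 p q h
        have ap := eq_of_cost_eq_zero (A p) a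
        have aq := eq_of_cost_eq_zero (A q) a
        have bp := eq_of_cost_eq_zero (B p) b
        have bq := eq_of_cost_eq_zero (B q) b
        have ne : ∀ c d : ℕ∞, c + d ≤ ((k + 1 : ℕ) : ℕ∞) → ∃ c' d' : ℕ,
            c = c' ∧ d = d' ∧ c' + d' ≤ k + 1 := by
          intro c d hcd
          have hne : c + d ≠ ⊤ := ne_top_of_le_ne_top (ENat.natCast_ne_top _) hcd
          rw [ne_eq, ENat.add_eq_top, not_or] at hne
          lift c to ℕ using hne.1
          lift d to ℕ using hne.2
          exact ⟨c, d, rfl, rfl, by exact_mod_cast hcd⟩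
        obtain ⟨x, y, hx, hy, hxy⟩ := ne _ _ hp
        obtain ⟨z, w, hz, hw, hzw⟩ := ne _ _ hq
        rw [hx] at a1 ap
        rw [hz] at a1 aq
        rw [hy] at b1 bp
        rw [hw] at b1 bq
        simp only [Nat.cast_le, Nat.cast_eq_zero] at a1 b1 ap aq bp bq
        -- In each half, `p` and `q` cannot both have cost at most `k`. Hence `q` spends all of its
        -- budget `k + 1` in one half and agrees with `t` in the other, where `p` would then have to
        -- pay at least `k + 2`.
        by_cases hxk : x ≤ k
        · have : k < z := by by_contra hz; exact a1 hxk (by omega)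
          have hb := bq (by omega)
          rw [hb, hy] at b2
          have : k + 2 ≤ y := by exact_mod_cast b2
          omega
        · have : k < w := by by_contra hw; exact b1 (by omega) (by omega)
          have ha := aq (by omega)
          rw [ha, hx] at a2
          have : k + 2 ≤ x := by exact_mod_cast a2
          omega
    · calc ((k + 1 : ℕ) : ℕ∞) + 2 ≤ (k + 2) + (k + 2) := by
            norm_cast
            omega
        _ ≤ _ := add_le_add (hA2 p q h) (hB2 p q h)

/-! ### Prime implicates from selections -/

section Clauses

variable {VA : Type*} [DecidableEq VA]

namespace LeafSelection

/-- The clause given by a selection: the literals on the paths to selected leaves whose complements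
are not on such paths, together with the doping literals of the selected leaves. -/
def clause : {T : BinaryTree VA} → (Finset (Lit VA) → VA) → LeafSelection T → Finset (Lit VA)
  | _, u, .leaf => {Lit.pos (u ∅)}
  | .node v _ _, u, .left s => insert (Lit.pos v) (clause (fun D => u (insert (Lit.pos v) D)) s)
  | .node v _ _, u, .right t => insert (Lit.neg v) (clause (fun D => u (insert (Lit.neg v) D)) t)
  | .node v _ _, u, .both s t => clause (fun D => u (insert (Lit.pos v) D)) s ∪
      clause (fun D => u (insert (Lit.neg v) D)) t

theorem clause_nonempty {T : BinaryTree VA} (u : Finset (Lit VA) → VA) (s : LeafSelection T) :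
    (clause u s).Nonempty := by
  induction s generalizing u with
  | leaf => simp [clause]
  | left s ih => simp [clause]
  | right s ih => simp [clause]
  | both s t ihs iht => exact (ihs _).mono Finset.subset_union_left

end LeafSelection

theorem smuOne_nonempty (T : BinaryTree VA) : (smuOne T).Nonempty := by
  induction T with
  | nil => simp [smuOne]
  | node v l r ihl ihr => exact (ihl.image _).mono Finset.subset_union_left

theorem mem_clauseSetVars {F : Finset (Finset (Lit VA))} {v : VA} :
    v ∈ clauseSetVars F ↔ ∃ C ∈ F, ∃ x ∈ C, x.1 = v := by
  simp [clauseSetVars, Lit.var]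

theorem mem_clauseSetVars_smuOne_node {v : VA} {l r : BinaryTree VA} {w : VA} :
    w ∈ clauseSetVars (smuOne (.node v l r)) ↔
      w = v ∨ w ∈ clauseSetVars (smuOne l) ∨ w ∈ clauseSetVars (smuOne r) := by
  simp only [mem_clauseSetVars, smuOne, Finset.mem_union, Finset.mem_image]
  constructor
  · rintro ⟨_, ⟨C, hC, rfl⟩ | ⟨C, hC, rfl⟩, x, hx, rfl⟩ <;>
      rcases Finset.mem_insert.1 hx with rfl | hx
    · exact Or.inl rfl
    · exact Or.inr (Or.inl ⟨C, hC, x, hx, rfl⟩)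
    · exact Or.inl rfl
    · exact Or.inr (Or.inr ⟨C, hC, x, hx, rfl⟩)
  · rintro (rfl | ⟨C, hC, x, hx, rfl⟩ | ⟨C, hC, x, hx, rfl⟩)
    · obtain ⟨C, hC⟩ := smuOne_nonempty l
      exact ⟨_, Or.inl ⟨C, hC, rfl⟩, _, Finset.mem_insert_self _ _, rfl⟩
    · exact ⟨_, Or.inl ⟨C, hC, rfl⟩, x, Finset.mem_insert_of_mem hx, rfl⟩
    · exact ⟨_, Or.inr ⟨C, hC, rfl⟩, x, Finset.mem_insert_of_mem hx, rfl⟩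

theorem mem_clauseSetVars_smuOne (T : BinaryTree VA) (w : VA) :
    w ∈ clauseSetVars (smuOne T) ↔ w ∈ innerLabels T := by
  induction T with
  | nil => simp [mem_clauseSetVars, smuOne, innerLabels]
  | node v l r ihl ihr => simp [mem_clauseSetVars_smuOne_node, innerLabels, ihl, ihr]

/-- The facts about an injectively labelled tree and a doping that are inherited by subtrees. -/
structure IsDopedTree (u : Finset (Lit VA) → VA) (T : BinaryTree VA) : Prop where
  labelled : InjectivelyLabelled T
  assignment : IsDopingAssignment u (smuOne T)

/-- The variables of the doping of the clause-set of a tree. -/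
def dopedVars (u : Finset (Lit VA) → VA) (T : BinaryTree VA) : Set VA :=
  {w | w ∈ innerLabels T ∨ ∃ D ∈ smuOne T, w = u D}

theorem LeafSelection.mem_dopedVars_of_mem_clause {T : BinaryTree VA} (u : Finset (Lit VA) → VA)
    (s : LeafSelection T) {x : Lit VA} (hx : x ∈ clause u s) : x.1 ∈ dopedVars u T := by
  induction s generalizing u with
  | leaf => exact Or.inr ⟨∅, by simp [smuOne], by simp_all [clause, Lit.pos]⟩
  | @left v l r s ih =>
    rcases Finset.mem_insert.1 hx with rfl | hx
    · exact Or.inl (by simp [innerLabels, Lit.pos])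
    · rcases ih _ hx with h | ⟨D, hD, h⟩
      · exact Or.inl (by simp [innerLabels, h])
      · exact Or.inr ⟨_, Finset.mem_union_left _ (Finset.mem_image_of_mem _ hD), h⟩
  | @right v l r s ih =>
    rcases Finset.mem_insert.1 hx with rfl | hx
    · exact Or.inl (by simp [innerLabels, Lit.neg])
    · rcases ih _ hx with h | ⟨D, hD, h⟩
      · exact Or.inl (by simp [innerLabels, h])
      · exact Or.inr ⟨_, Finset.mem_union_right _ (Finset.mem_image_of_mem _ hD), h⟩
  | both s t ihs iht =>
    rcases Finset.mem_union.1 hx with hx | hx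
    · rcases ihs _ hx with h | ⟨D, hD, h⟩
      · exact Or.inl (by simp [innerLabels, h])
      · exact Or.inr ⟨_, Finset.mem_union_left _ (Finset.mem_image_of_mem _ hD), h⟩
    · rcases iht _ hx with h | ⟨D, hD, h⟩
      · exact Or.inl (by simp [innerLabels, h])
      · exact Or.inr ⟨_, Finset.mem_union_right _ (Finset.mem_image_of_mem _ hD), h⟩

namespace IsDopedTree

variable {u : Finset (Lit VA) → VA} {v : VA} {l r : BinaryTree VA}

theorem nodup (h : IsDopedTree u (.node v l r)) : v ∉ innerLabels l ∧ v ∉ innerLabels r ∧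
    (innerLabels l).Nodup ∧ (innerLabels r).Nodup ∧
      ∀ w ∈ innerLabels l, w ∉ innerLabels r := by
  have := h.labelled
  simp only [InjectivelyLabelled, innerLabels, List.nodup_cons, List.mem_append, not_or,
    List.nodup_append] at this
  exact ⟨this.1.1, this.1.2, this.2.1, this.2.2.1, fun w hw hw' => this.2.2.2 w hw w hw' rfl⟩

/-- Leaf clauses of the subtree lack the literal of the edge above it, so `u` is precomposed with
adding it. Injectivity survives because `v` does not occur in `l`. -/
theorem left (h : IsDopedTree u (.node v l r)) :
    IsDopedTree (fun D => u (insert (Lit.pos v) D)) l := by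
  have hmem : ∀ D ∈ smuOne l, insert (Lit.pos v) D ∈ smuOne (.node v l r) := fun D hD =>
    Finset.mem_union_left _ (Finset.mem_image_of_mem _ hD)
  have hv : ∀ D ∈ smuOne l, Lit.pos v ∉ D := fun D hD hx =>
    h.nodup.1 (var_mem_innerLabels l D hD _ hx)
  refine ⟨h.nodup.2.2.1, fun D hD D' hD' hu => ?_, fun D hD hx => ?_⟩
  · have := h.assignment.1 (hmem D hD) (hmem D' hD') hu
    rw [← Finset.erase_insert (hv D hD), this, Finset.erase_insert (hv D' hD')]
  · exact h.assignment.2 _ (hmem D hD)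
      (mem_clauseSetVars_smuOne_node.2 (Or.inr (Or.inl hx)))

theorem right (h : IsDopedTree u (.node v l r)) :
    IsDopedTree (fun D => u (insert (Lit.neg v) D)) r := by
  have hmem : ∀ D ∈ smuOne r, insert (Lit.neg v) D ∈ smuOne (.node v l r) := fun D hD =>
    Finset.mem_union_right _ (Finset.mem_image_of_mem _ hD)
  have hv : ∀ D ∈ smuOne r, Lit.neg v ∉ D := fun D hD hx =>
    h.nodup.2.1 (var_mem_innerLabels r D hD _ hx)
  refine ⟨h.nodup.2.2.2.1, fun D hD D' hD' hu => ?_, fun D hD hx => ?_⟩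
  · have := h.assignment.1 (hmem D hD) (hmem D' hD') hu
    rw [← Finset.erase_insert (hv D hD), this, Finset.erase_insert (hv D' hD')]
  · exact h.assignment.2 _ (hmem D hD)
      (mem_clauseSetVars_smuOne_node.2 (Or.inr (Or.inr hx)))

theorem label_notMem_left (h : IsDopedTree u (.node v l r)) :
    v ∉ dopedVars (fun D => u (insert (Lit.pos v) D)) l := by
  rintro (hv | ⟨D, hD, hv⟩)
  · exact h.nodup.1 hv
  · exact h.assignment.2 _ (Finset.mem_union_left _ (Finset.mem_image_of_mem _ hD))
      (mem_clauseSetVars_smuOne_node.2 (Or.inl hv.symm))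

theorem label_notMem_right (h : IsDopedTree u (.node v l r)) :
    v ∉ dopedVars (fun D => u (insert (Lit.neg v) D)) r := by
  rintro (hv | ⟨D, hD, hv⟩)
  · exact h.nodup.2.1 hv
  · exact h.assignment.2 _ (Finset.mem_union_right _ (Finset.mem_image_of_mem _ hD))
      (mem_clauseSetVars_smuOne_node.2 (Or.inl hv.symm))

/-- A doping variable shared by both sides would come from one leaf clause, which would contain both
`v` and its complement. -/
theorem disjoint_dopedVars (h : IsDopedTree u (.node v l r)) :
    Disjoint (dopedVars (fun D => u (insert (Lit.pos v) D)) l)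
      (dopedVars (fun D => u (insert (Lit.neg v) D)) r) := by
  have hl : ∀ D ∈ smuOne l, insert (Lit.pos v) D ∈ smuOne (.node v l r) := fun D hD =>
    Finset.mem_union_left _ (Finset.mem_image_of_mem _ hD)
  have hr : ∀ D ∈ smuOne r, insert (Lit.neg v) D ∈ smuOne (.node v l r) := fun D hD =>
    Finset.mem_union_right _ (Finset.mem_image_of_mem _ hD)
  rw [Set.disjoint_left]
  rintro w (hw | ⟨D, hD, rfl⟩) (hw' | ⟨D', hD', hw'⟩)
  · exact h.nodup.2.2.2.2 w hw hw'
  · subst hw'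
    exact h.assignment.2 _ (hr D' hD')
      ((mem_clauseSetVars_smuOne _ _).2 (by simp [innerLabels, hw]))
  · exact h.assignment.2 _ (hl D hD)
      ((mem_clauseSetVars_smuOne _ _).2 (by simp [innerLabels, hw']))
  · have heq := h.assignment.1 (hl D hD) (hr D' hD') hw'
    have hv : Lit.pos v ∈ insert (Lit.neg v) D' := heq ▸ Finset.mem_insert_self _ _
    rcases Finset.mem_insert.1 hv with hv | hv
    · simp [Lit.pos, Lit.neg] at hv
    · exact h.nodup.2.1 (var_mem_innerLabels r D' hD' _ hv)

end IsDopedTree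

theorem mem_complLits {L : Finset (Lit VA)} {x : Lit VA} : x ∈ complLits L ↔ x.compl ∈ L := by
  simp only [complLits, Finset.mem_image]
  constructor
  · rintro ⟨y, hy, rfl⟩
    simpa [Lit.compl] using hy
  · exact fun h => ⟨_, h, by simp [Lit.compl]⟩

theorem inter_complLits_eq_empty {C D : Finset (Lit VA)} :
    C ∩ complLits D = ∅ ↔ ∀ x ∈ C, x.compl ∉ D := by
  simp [Finset.eq_empty_iff_forall_notMem, mem_complLits]

namespace LeafSelection

/-- The two subtrees have disjoint variables, so missing literals on both sides add up. A non-clash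
excludes the infinite values. -/
theorem cost_le_card {T : BinaryTree VA} {u : Finset (Lit VA) → VA} (hT : IsDopedTree u T)
    (s t : LeafSelection T) (hst : clause u t ∩ complLits (clause u s) = ∅) :
    cost s t ≤ (clause u t \ clause u s).card := by
  rw [inter_complLits_eq_empty] at hst
  induction s generalizing u with
  | leaf => cases t; simp [cost]
  | @left v l r a ih =>
    have hvl := hT.label_notMem_left
    have hd := Set.disjoint_left.1 hT.disjoint_dopedVars
    have ha : ∀ x, _ → _ := fun x hx =>
      mem_dopedVars_of_mem_clause (fun D => u (insert (Lit.pos v) D)) a (x := x) hx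
    rcases t with _ | a' | b' | ⟨a', b'⟩
    · refine (ih hT.left a' fun x hx h => hst x (Finset.mem_insert_of_mem hx)
        (Finset.mem_insert_of_mem h)).trans ?_
      have ha' : ∀ x, _ → _ := fun x hx =>
        mem_dopedVars_of_mem_clause (fun D => u (insert (Lit.pos v) D)) a' (x := x) hx
      refine Nat.cast_le.2 (Finset.card_le_card fun x hx => ?_)
      simp only [clause, Finset.mem_sdiff, Finset.mem_insert, not_or] at hx ⊢
      refine ⟨Or.inr hx.1, ?_, hx.2⟩
      rintro rfl
      exact hvl (ha' _ hx.1)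
    · exact absurd (Finset.mem_insert_self _ _) (hst (Lit.neg v) (Finset.mem_insert_self _ _))
    · have ha' : ∀ x, _ → _ := fun x hx =>
        mem_dopedVars_of_mem_clause (fun D => u (insert (Lit.pos v) D)) a' (x := x) hx
      have hb' : ∀ x, _ → _ := fun x hx =>
        mem_dopedVars_of_mem_clause (fun D => u (insert (Lit.neg v) D)) b' (x := x) hx
      have h1 := ih hT.left a' fun x hx h => hst x (Finset.mem_union_left _ hx)
        (Finset.mem_insert_of_mem h)
      -- The extra 1 is any literal from the half that only `t` visits.
      obtain ⟨y, hy⟩ := clause_nonempty (fun D => u (insert (Lit.neg v) D)) b'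
      have hy' : y ∉ clause (fun D => u (insert (Lit.pos v) D)) a' \
          clause (fun D => u (insert (Lit.pos v) D)) a := fun h =>
        hd (ha' _ (Finset.mem_sdiff.1 h).1) (hb' _ hy)
      have hyv : y ≠ Lit.pos v := by
        rintro rfl
        exact hT.label_notMem_right (hb' _ hy)
      refine (add_le_add h1 le_rfl).trans ?_
      rw [← Nat.cast_one, ← Nat.cast_add, ← Finset.card_insert_of_notMem hy']
      refine Nat.cast_le.2 (Finset.card_le_card fun x hx => ?_)
      simp only [clause, Finset.mem_sdiff, Finset.mem_insert, not_or, Finset.mem_union] at hx ⊢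
      rcases hx with rfl | hx
      · exact ⟨Or.inr hy, hyv, fun h => hd (ha _ h) (hb' _ hy)⟩
      · refine ⟨Or.inl hx.1, ?_, hx.2⟩
        rintro rfl
        exact hvl (ha' _ hx.1)
  | @right v l r b ih =>
    have hvr := hT.label_notMem_right
    have hd := Set.disjoint_left.1 hT.disjoint_dopedVars
    have hb : ∀ x, _ → _ := fun x hx =>
      mem_dopedVars_of_mem_clause (fun D => u (insert (Lit.neg v) D)) b (x := x) hx
    rcases t with _ | a' | b' | ⟨a', b'⟩
    · exact absurd (Finset.mem_insert_self _ _) (hst (Lit.pos v) (Finset.mem_insert_self _ _))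
    · refine (ih hT.right b' fun x hx h => hst x (Finset.mem_insert_of_mem hx)
        (Finset.mem_insert_of_mem h)).trans ?_
      have hb' : ∀ x, _ → _ := fun x hx =>
        mem_dopedVars_of_mem_clause (fun D => u (insert (Lit.neg v) D)) b' (x := x) hx
      refine Nat.cast_le.2 (Finset.card_le_card fun x hx => ?_)
      simp only [clause, Finset.mem_sdiff, Finset.mem_insert, not_or] at hx ⊢
      refine ⟨Or.inr hx.1, ?_, hx.2⟩
      rintro rfl
      exact hvr (hb' _ hx.1)
    · have ha' : ∀ x, _ → _ := fun x hx =>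
        mem_dopedVars_of_mem_clause (fun D => u (insert (Lit.pos v) D)) a' (x := x) hx
      have hb' : ∀ x, _ → _ := fun x hx =>
        mem_dopedVars_of_mem_clause (fun D => u (insert (Lit.neg v) D)) b' (x := x) hx
      have h1 := ih hT.right b' fun x hx h => hst x (Finset.mem_union_right _ hx)
        (Finset.mem_insert_of_mem h)
      obtain ⟨y, hy⟩ := clause_nonempty (fun D => u (insert (Lit.pos v) D)) a'
      have hy' : y ∉ clause (fun D => u (insert (Lit.neg v) D)) b' \
          clause (fun D => u (insert (Lit.neg v) D)) b := fun h =>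
        hd (ha' _ hy) (hb' _ (Finset.mem_sdiff.1 h).1)
      have hyv : y ≠ Lit.neg v := by
        rintro rfl
        exact hT.label_notMem_left (ha' _ hy)
      refine (add_le_add h1 le_rfl).trans ?_
      rw [← Nat.cast_one, ← Nat.cast_add, ← Finset.card_insert_of_notMem hy']
      refine Nat.cast_le.2 (Finset.card_le_card fun x hx => ?_)
      simp only [clause, Finset.mem_sdiff, Finset.mem_insert, not_or, Finset.mem_union] at hx ⊢
      rcases hx with rfl | hx
      · exact ⟨Or.inl hy, hyv, fun h => hd (ha' _ hy) (hb _ h)⟩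
      · refine ⟨Or.inr hx.1, ?_, hx.2⟩
        rintro rfl
        exact hvr (hb' _ hx.1)
  | @both v l r a b iha ihb =>
    have hvl := hT.label_notMem_left
    have hvr := hT.label_notMem_right
    have hd := Set.disjoint_left.1 hT.disjoint_dopedVars
    have ha : ∀ x, _ → _ := fun x hx =>
      mem_dopedVars_of_mem_clause (fun D => u (insert (Lit.pos v) D)) a (x := x) hx
    have hb : ∀ x, _ → _ := fun x hx =>
      mem_dopedVars_of_mem_clause (fun D => u (insert (Lit.neg v) D)) b (x := x) hx
    rcases t with _ | a' | b' | ⟨a', b'⟩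
    · have ha' : ∀ x, _ → _ := fun x hx =>
        mem_dopedVars_of_mem_clause (fun D => u (insert (Lit.pos v) D)) a' (x := x) hx
      have h1 := iha hT.left a' fun x hx h => hst x (Finset.mem_insert_of_mem hx)
        (Finset.mem_union_left _ h)
      -- The extra 1 is now `v` itself, which is resolved away in the clause of `both a b`.
      have hv : Lit.pos v ∉ clause (fun D => u (insert (Lit.pos v) D)) a' \
          clause (fun D => u (insert (Lit.pos v) D)) a := fun h =>
        hvl (ha' _ (Finset.mem_sdiff.1 h).1)
      refine (add_le_add h1 le_rfl).trans ?_
      rw [← Nat.cast_one, ← Nat.cast_add, ← Finset.card_insert_of_notMem hv]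
      refine Nat.cast_le.2 (Finset.card_le_card fun x hx => ?_)
      simp only [clause, Finset.mem_sdiff, Finset.mem_insert, not_or, Finset.mem_union] at hx ⊢
      rcases hx with rfl | hx
      · exact ⟨Or.inl rfl, fun h => hvl (ha _ h), fun h => hvr (hb _ h)⟩
      · exact ⟨Or.inr hx.1, hx.2, fun h => hd (ha' _ hx.1) (hb _ h)⟩
    · have hb' : ∀ x, _ → _ := fun x hx =>
        mem_dopedVars_of_mem_clause (fun D => u (insert (Lit.neg v) D)) b' (x := x) hx
      have h1 := ihb hT.right b' fun x hx h => hst x (Finset.mem_insert_of_mem hx)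
        (Finset.mem_union_right _ h)
      have hv : Lit.neg v ∉ clause (fun D => u (insert (Lit.neg v) D)) b' \
          clause (fun D => u (insert (Lit.neg v) D)) b := fun h =>
        hvr (hb' _ (Finset.mem_sdiff.1 h).1)
      refine (add_le_add h1 le_rfl).trans ?_
      rw [← Nat.cast_one, ← Nat.cast_add, ← Finset.card_insert_of_notMem hv]
      refine Nat.cast_le.2 (Finset.card_le_card fun x hx => ?_)
      simp only [clause, Finset.mem_sdiff, Finset.mem_insert, not_or, Finset.mem_union] at hx ⊢
      rcases hx with rfl | hx
      · exact ⟨Or.inl rfl, fun h => hvl (ha _ h), fun h => hvr (hb _ h)⟩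
      · exact ⟨Or.inr hx.1, fun h => hd (ha _ h) (hb' _ hx.1), hx.2⟩
    · have ha' : ∀ x, _ → _ := fun x hx =>
        mem_dopedVars_of_mem_clause (fun D => u (insert (Lit.pos v) D)) a' (x := x) hx
      have hb' : ∀ x, _ → _ := fun x hx =>
        mem_dopedVars_of_mem_clause (fun D => u (insert (Lit.neg v) D)) b' (x := x) hx
      have h1 := iha hT.left a' fun x hx h => hst x (Finset.mem_union_left _ hx)
        (Finset.mem_union_left _ h)
      have h2 := ihb hT.right b' fun x hx h => hst x (Finset.mem_union_right _ hx)
        (Finset.mem_union_right _ h)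
      refine (add_le_add h1 h2).trans ?_
      rw [← Nat.cast_add, ← Finset.card_union_of_disjoint (Finset.disjoint_left.2 fun x hx hx' =>
        hd (ha' _ (Finset.mem_sdiff.1 hx).1) (hb' _ (Finset.mem_sdiff.1 hx').1))]
      refine Nat.cast_le.2 (Finset.card_le_card fun x hx => ?_)
      simp only [clause, Finset.mem_sdiff, not_or, Finset.mem_union] at hx ⊢
      rcases hx with hx | hx
      · exact ⟨Or.inl hx.1, hx.2, fun h => hd (ha' _ hx.1) (hb _ h)⟩
      · exact ⟨Or.inr hx.1, fun h => hd (ha _ h) (hb' _ hx.1), hx.2⟩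

end LeafSelection

/-! ### Derivability -/

/-- Adding a literal with a new variable to all axioms adds it to the derived clauses. -/
theorem ResDerives.insert {F F' : Finset (Finset (Lit VA))} {x : Lit VA}
    (hx : ∀ D ∈ F, ∀ y ∈ D, y.1 ≠ x.1) (hF : ∀ D ∈ F, insert x D ∈ F') {C : Finset (Lit VA)}
    (h : ResDerives F C) : ResDerives F' (insert x C) ∧ ∀ y ∈ C, y.1 ≠ x.1 := by
  induction h with
  | leaf C hC => exact ⟨.leaf _ (hF C hC), hx C hC⟩
  | node C D z hC hD hz ihC ihD =>
    have hzC : z ∈ C ∧ z.compl ∈ D := by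
      have : z ∈ C ∩ complLits D := hz ▸ Finset.mem_singleton_self z
      rwa [Finset.mem_inter, mem_complLits] at this
    have hzx := ihC.2 z hzC.1
    refine ⟨?_, fun y hy => ?_⟩
    · convert ResDerives.node _ _ z ihC.1 ihD.1 ?_ using 1
      · ext y
        simp only [Finset.mem_insert, Finset.mem_sdiff, Finset.mem_union, Finset.mem_singleton]
        have h1 : y = x → ¬ (y = z ∨ y = z.compl) := by
          rintro rfl (rfl | rfl)
          · exact hzx rfl
          · exact hzx rfl
        tauto
      -- The complement of `x` occurs in neither premise, so adding `x` creates no new clash.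
      · rw [← hz]
        ext y
        simp only [Finset.mem_insert, Finset.mem_inter, mem_complLits]
        have h1 : y = x → y.compl ≠ x := by
          rintro rfl h
          simpa [Lit.compl] using congrArg Prod.snd h
        have h2 : y = x → y.compl ∉ D := by
          rintro rfl h
          exact ihD.2 _ h rfl
        have h3 : y ∈ C → y.compl ≠ x := by
          rintro h rfl
          exact ihC.2 _ h rfl
        tauto
    · rcases Finset.mem_union.1 (Finset.mem_sdiff.1 hy).1 with h | h
      · exact ihC.2 y h
      · exact ihD.2 y h

/-- The premises clash only in the literal resolved on, and both of its signs are removed. -/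
theorem ResDerives.isClause {F : Finset (Finset (Lit VA))} (hF : IsClauseSet F)
    {C : Finset (Lit VA)} (h : ResDerives F C) : IsClause C := by
  induction h with
  | leaf C hC => exact hF C hC
  | node C D z hC hD hz ihC ihD =>
    rw [IsClause, inter_complLits_eq_empty] at *
    have key : ∀ y, y ∈ C → y.compl ∈ D → y = z := fun y h1 h2 => by
      rw [← Finset.mem_singleton, ← hz, Finset.mem_inter, mem_complLits]
      exact ⟨h1, h2⟩
    have hcc : ∀ y : Lit VA, y.compl.compl = y := fun y => by simp [Lit.compl]
    intro y hy hy'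
    simp only [Finset.mem_sdiff, Finset.mem_union, Finset.mem_insert, Finset.mem_singleton,
      not_or] at hy hy'
    rcases hy.1 with h1 | h1 <;> rcases hy'.1 with h2 | h2
    · exact ihC y h1 h2
    · exact hy.2.1 (key y h1 h2)
    · exact hy'.2.1 (key _ h2 (by rwa [hcc]))
    · exact ihD y h1 h2

/-- The total assignment `φ` falsifies all literals of `C`. -/
def Falsifies (φ : VA → Bool) (C : Finset (Lit VA)) : Prop := ∀ x ∈ C, φ x.1 ≠ x.2

/-- The value of `φ` at the resolution variable selects a falsified premise; complement-freeness
keeps the opposite sign out of that premise. -/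
theorem ResDerives.sound {F : Finset (Finset (Lit VA))} (hF : IsClauseSet F)
    {C : Finset (Lit VA)} (h : ResDerives F C) (φ : VA → Bool) (hφ : Falsifies φ C) :
    ∃ D ∈ F, Falsifies φ D := by
  induction h with
  | leaf C hC => exact ⟨C, hC, hφ⟩
  | node C D z hC hD hz ihC ihD =>
    have hzC : z ∈ C ∧ z.compl ∈ D := by
      have : z ∈ C ∩ complLits D := hz ▸ Finset.mem_singleton_self z
      rwa [Finset.mem_inter, mem_complLits] at this
    have hC' := inter_complLits_eq_empty.1 (hC.isClause hF)
    have hD' := inter_complLits_eq_empty.1 (hD.isClause hF)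
    by_cases hφz : φ z.1 = z.2
    · refine ihD fun y hy => ?_
      by_cases h1 : y = z
      · exact absurd hzC.2 (hD' z (h1 ▸ hy))
      by_cases h2 : y = z.compl
      · simp [h2, Lit.compl, hφz]
      · exact hφ y (by simp [hy, h1, h2])
    · refine ihC fun y hy => ?_
      by_cases h1 : y = z
      · rwa [h1]
      by_cases h2 : y = z.compl
      · exact absurd (h2 ▸ hy) (hC' z hzC.1)
      · exact hφ y (by simp [hy, h1, h2])

theorem mem_doping_smuOne_node {u : Finset (Lit VA) → VA} {v : VA} {l r : BinaryTree VA}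
    {D : Finset (Lit VA)} : D ∈ doping u (smuOne (.node v l r)) ↔
      (∃ E ∈ doping (fun D => u (insert (Lit.pos v) D)) (smuOne l), D = insert (Lit.pos v) E) ∨
      ∃ E ∈ doping (fun D => u (insert (Lit.neg v) D)) (smuOne r), D = insert (Lit.neg v) E := by
  simp only [doping, smuOne, Finset.mem_image, Finset.mem_union]
  constructor
  · rintro ⟨_, ⟨E, hE, rfl⟩ | ⟨E, hE, rfl⟩, rfl⟩
    · exact Or.inl ⟨_, ⟨E, hE, rfl⟩, Finset.insert_comm _ _ _⟩
    · exact Or.inr ⟨_, ⟨E, hE, rfl⟩, Finset.insert_comm _ _ _⟩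
  · rintro (⟨_, ⟨E, hE, rfl⟩, rfl⟩ | ⟨_, ⟨E, hE, rfl⟩, rfl⟩)
    · exact ⟨_, Or.inl ⟨E, hE, rfl⟩, Finset.insert_comm _ _ _⟩
    · exact ⟨_, Or.inr ⟨E, hE, rfl⟩, Finset.insert_comm _ _ _⟩

theorem mem_dopedVars_of_mem_doping {u : Finset (Lit VA) → VA} {T : BinaryTree VA}
    {D : Finset (Lit VA)} (hD : D ∈ doping u (smuOne T)) {x : Lit VA} (hx : x ∈ D) :
    x.1 ∈ dopedVars u T := by
  obtain ⟨E, hE, rfl⟩ := Finset.mem_image.1 hD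
  rcases Finset.mem_insert.1 hx with rfl | hx
  · exact Or.inr ⟨E, hE, rfl⟩
  · exact Or.inl (var_mem_innerLabels T E hE x hx)

/-! ### Selection clauses as prime implicates, and the resulting matching. -/

namespace IsDopedTree

open LeafSelection

variable {u : Finset (Lit VA) → VA} {T : BinaryTree VA}

theorem isClauseSet (hT : IsDopedTree u T) : IsClauseSet (doping u (smuOne T)) :=
  isClauseSet_doping u _ (isClauseSet_smuOne T hT.labelled) hT.assignment

theorem resDerives_clause (hT : IsDopedTree u T) (s : LeafSelection T) :
    ResDerives (doping u (smuOne T)) (clause u s) := by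
  have hL : ∀ {u : Finset (Lit VA) → VA} {v : VA} {l r : BinaryTree VA},
      IsDopedTree u (.node v l r) → ∀ {C : Finset (Lit VA)},
      ResDerives (doping (fun D => u (insert (Lit.pos v) D)) (smuOne l)) C →
      ResDerives (doping u (smuOne (.node v l r))) (insert (Lit.pos v) C) :=
    fun hT _ hC => (hC.insert
      (fun D hD y hy =>
        ne_of_mem_of_not_mem (mem_dopedVars_of_mem_doping hD hy) hT.label_notMem_left)
      fun D hD => mem_doping_smuOne_node.2 (Or.inl ⟨D, hD, rfl⟩)).1
  have hR : ∀ {u : Finset (Lit VA) → VA} {v : VA} {l r : BinaryTree VA},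
      IsDopedTree u (.node v l r) → ∀ {C : Finset (Lit VA)},
      ResDerives (doping (fun D => u (insert (Lit.neg v) D)) (smuOne r)) C →
      ResDerives (doping u (smuOne (.node v l r))) (insert (Lit.neg v) C) :=
    fun hT _ hC => (hC.insert
      (fun D hD y hy =>
        ne_of_mem_of_not_mem (mem_dopedVars_of_mem_doping hD hy) hT.label_notMem_right)
      fun D hD => mem_doping_smuOne_node.2 (Or.inr ⟨D, hD, rfl⟩)).1
  induction s generalizing u with
  | leaf => exact .leaf _ (by simp [doping, smuOne, clause])
  | left s ih => exact hL hT (ih hT.left)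
  | right t ih => exact hR hT (ih hT.right)
  | @both v l r s t ihs iht =>
    have hs : ∀ x, _ → _ := fun x hx =>
      mem_dopedVars_of_mem_clause (fun D => u (insert (Lit.pos v) D)) s (x := x) hx
    have ht : ∀ x, _ → _ := fun x hx =>
      mem_dopedVars_of_mem_clause (fun D => u (insert (Lit.neg v) D)) t (x := x) hx
    have hd := Set.disjoint_left.1 hT.disjoint_dopedVars
    -- By disjointness of the variables of the two subtrees, `v` is the only clash.
    convert ResDerives.node _ _ (Lit.pos v) (hL hT (ihs hT.left)) (hR hT (iht hT.right)) ?_ using 1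
    · ext y
      have h1 : y ∈ clause (fun D => u (insert (Lit.pos v) D)) s → y.1 ≠ v := fun h h' =>
        hT.label_notMem_left (h' ▸ hs y h)
      have h2 : y ∈ clause (fun D => u (insert (Lit.neg v) D)) t → y.1 ≠ v := fun h h' =>
        hT.label_notMem_right (h' ▸ ht y h)
      have h3 : y = Lit.pos v → y.1 = v := fun h => h ▸ rfl
      have h4 : y = Lit.neg v → y.1 = v := fun h => h ▸ rfl
      have h5 : (Lit.pos v).compl = Lit.neg v := rfl
      simp only [clause, Finset.mem_sdiff, Finset.mem_union, Finset.mem_insert,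
        Finset.mem_singleton, h5]
      tauto
    · ext y
      simp only [Finset.mem_inter, mem_complLits, Finset.mem_insert, Finset.mem_singleton]
      constructor
      · rintro ⟨rfl | h1, h2⟩
        · rfl
        · rcases h2 with h2 | h2
          · exact absurd (hs y h1) ((congrArg Prod.fst h2 : y.1 = v) ▸ hT.label_notMem_left)
          · exact (hd (hs y h1) (show y.1 ∈ _ from ht y.compl h2)).elim
      · rintro rfl
        exact ⟨Or.inl rfl, Or.inl rfl⟩

/-- Every implicate of the doping contains the clause given by some selection. -/
theorem exists_clause_subset (hT : IsDopedTree u T) {C : Finset (Lit VA)} (hC : IsClause C)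
    (h : ∀ φ, Falsifies φ C → ∃ D ∈ doping u (smuOne T), Falsifies φ D) :
    ∃ s : LeafSelection T, clause u s ⊆ C := by
  classical
  have hcl := inter_complLits_eq_empty.1 hC
  induction T generalizing u with
  | nil =>
    refine ⟨.leaf, ?_⟩
    by_contra hu
    simp only [clause, Finset.singleton_subset_iff] at hu
    -- This assignment falsifies `C` but satisfies the only axiom `{u ∅}`.
    obtain ⟨D, hD, hφ⟩ := h (fun w => decide (w = u ∅ ∨ Lit.neg w ∈ C)) fun x hx => by
      obtain ⟨w, b⟩ := x
      cases b
      · simp [Lit.neg, hx]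
      · have h1 : w ≠ u ∅ := by
          rintro rfl
          exact hu hx
        have h2 : (w, false) ∉ C := hcl _ hx
        simp [h1, Lit.neg, h2]
    simp only [doping, smuOne, Finset.image_singleton, Finset.mem_singleton] at hD
    subst hD
    exact hφ (Lit.pos (u ∅)) (by simp) (by simp [Lit.pos])
  | node v l r ihl ihr =>
    have hl : Lit.neg v ∉ C → ∃ s : LeafSelection l,
        clause (fun D => u (insert (Lit.pos v) D)) s ⊆ C := fun hv => by
      refine ihl hT.left fun φ hφ => ?_
      -- Setting `v` to false keeps `C` falsified and satisfies all axioms from the right subtree,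
      -- so the falsified axiom lies on the left, where `v` plays no further role.
      obtain ⟨D, hD, hD'⟩ := h (Function.update φ v false) fun x hx => by
        obtain ⟨w, b⟩ := x
        by_cases hw : w = v
        · subst hw
          cases b
          · exact absurd hx hv
          · simp
        · simpa [Function.update_of_ne hw] using hφ _ hx
      rcases mem_doping_smuOne_node.1 hD with ⟨E, hE, rfl⟩ | ⟨E, hE, rfl⟩
      · refine ⟨E, hE, fun x hx => ?_⟩
        have hxv : x.1 ≠ v := fun h' =>
          hT.label_notMem_left (h' ▸ mem_dopedVars_of_mem_doping hE hx)
        simpa [Function.update_of_ne hxv] using hD' x (Finset.mem_insert_of_mem hx)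
      · exact absurd (by simp [Lit.neg]) (hD' (Lit.neg v) (Finset.mem_insert_self _ _))
    have hr : Lit.pos v ∉ C → ∃ s : LeafSelection r,
        clause (fun D => u (insert (Lit.neg v) D)) s ⊆ C := fun hv => by
      refine ihr hT.right fun φ hφ => ?_
      obtain ⟨D, hD, hD'⟩ := h (Function.update φ v true) fun x hx => by
        obtain ⟨w, b⟩ := x
        by_cases hw : w = v
        · subst hw
          cases b
          · simp
          · exact absurd hx hv
        · simpa [Function.update_of_ne hw] using hφ _ hx
      rcases mem_doping_smuOne_node.1 hD with ⟨E, hE, rfl⟩ | ⟨E, hE, rfl⟩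
      · exact absurd (by simp [Lit.pos]) (hD' (Lit.pos v) (Finset.mem_insert_self _ _))
      · refine ⟨E, hE, fun x hx => ?_⟩
        have hxv : x.1 ≠ v := fun h' =>
          hT.label_notMem_right (h' ▸ mem_dopedVars_of_mem_doping hE hx)
        simpa [Function.update_of_ne hxv] using hD' x (Finset.mem_insert_of_mem hx)
    by_cases hp : Lit.pos v ∈ C
    · obtain ⟨s, hs⟩ := hl (hcl _ hp)
      exact ⟨.left s, Finset.insert_subset hp hs⟩
    obtain ⟨t, ht⟩ := hr hp
    by_cases hn : Lit.neg v ∈ C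
    · exact ⟨.right t, Finset.insert_subset hn ht⟩
    · obtain ⟨s, hs⟩ := hl hn
      exact ⟨.both s t, Finset.union_subset hs ht⟩

theorem exists_clause_subset_of_resDerives (hT : IsDopedTree u T) {C : Finset (Lit VA)}
    (h : ResDerives (doping u (smuOne T)) C) : ∃ s : LeafSelection T, clause u s ⊆ C :=
  hT.exists_clause_subset (h.isClause hT.isClauseSet) (h.sound hT.isClauseSet)

/-- A derivable strict subclause would contain the clause of some `t` with `cost s t = 0`, hence `t
= s`. -/
theorem clause_mem_primeImplicates (hT : IsDopedTree u T) (s : LeafSelection T) :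
    clause u s ∈ primeImplicates (doping u (smuOne T)) := by
  have hs := hT.resDerives_clause s
  refine ⟨hs, fun C hC h => ?_⟩
  obtain ⟨t, ht⟩ := hT.exists_clause_subset_of_resDerives h
  have hcl := inter_complLits_eq_empty.1 (hs.isClause hT.isClauseSet)
  have hts := ht.trans hC.subset
  have hcost := cost_le_card hT s t (inter_complLits_eq_empty.2 fun x hx => hcl x (hts hx))
  rw [Finset.sdiff_eq_empty_iff_subset.2 hts] at hcost
  have := eq_of_cost_eq_zero s t (nonpos_iff_eq_zero.1 (by simpa using hcost))
  subst this
  exact hC.not_subset ht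

/-- The selections yielding subclauses of the elements of a hyperedge have small cost. -/
theorem exists_cost_le_of_mem_triggerEdge (hT : IsDopedTree u T) {k : ℕ}
    {C : Finset (Lit VA)} (hC : C ∈ primeImplicates (doping u (smuOne T))) :
    ∃ t : LeafSelection T, ∀ s : LeafSelection T,
      C ∈ triggerEdge (doping u (smuOne T)) k (clause u s) → cost s t ≤ k := by
  -- `t` depends on `C` only, so it serves all hyperedges containing `C` at once.
  obtain ⟨t, ht⟩ := hT.exists_clause_subset_of_resDerives hC.1
  refine ⟨t, fun s ⟨_, h1, h2⟩ => ?_⟩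
  rw [inter_complLits_eq_empty] at h1
  refine (cost_le_card hT s t (inter_complLits_eq_empty.2 fun x hx => h1 x (ht hx))).trans ?_
  exact Nat.cast_le.2 ((Finset.card_le_card (Finset.sdiff_subset_sdiff ht le_rfl)).trans h2)

theorem clause_mem_triggerEdge (hT : IsDopedTree u T) (k : ℕ) (s : LeafSelection T) :
    clause u s ∈ triggerEdge (doping u (smuOne T)) k (clause u s) :=
  ⟨hT.clause_mem_primeImplicates s, (hT.resDerives_clause s).isClause hT.isClauseSet, by simp⟩

/-- If the subtrees at depth `k` have height at least `n`, then the trigger hypergraph at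
level `k` has a matching indexed by the subsets of `{0, ..., n}` with `j` elements. -/
theorem choose_le_matchingNumber (hT : IsDopedTree u T) {n k : ℕ} (j : ℕ)
    (h : HighAtDepth n k T) :
    (((n + 1).choose j : ℕ) : ℕ∞) ≤ matchingNumber (triggerHypergraph (doping u (smuOne T)) k) := by
  classical
  obtain ⟨F, hF, -⟩ := exists_separated_selections n k T h
  let p : Finset ℕ → ℕ → Bool := fun S i => decide (i ∈ S)
  let e : Finset ℕ → Set (Finset (Lit VA)) := fun S =>
    triggerEdge (doping u (smuOne T)) k (clause u (F (p S)))
  let I := Finset.powersetCard j (Finset.range (n + 1))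
  have hdisj : ∀ S ∈ I, ∀ S' ∈ I, S ≠ S' → Disjoint (e S) (e S') := by
    intro S hS S' hS' hne
    rw [Finset.mem_powersetCard] at hS hS'
    have key : ∀ A B : Finset ℕ, A ⊆ Finset.range (n + 1) → A.card = B.card → A ≠ B →
        ∃ i ≤ n, p A i = true ∧ p B i = false := by
      intro A B hA hAB hne
      have : ¬ A ⊆ B := fun hsub => hne (Finset.eq_of_subset_of_card_le hsub hAB.ge)
      obtain ⟨i, hi, hi'⟩ := Finset.not_subset.1 this
      exact ⟨i, Nat.lt_succ_iff.1 (Finset.mem_range.1 (hA hi)), by simp [p, hi], by simp [p, hi']⟩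
    rw [Set.disjoint_left]
    intro C h1 h2
    obtain ⟨t, ht⟩ := hT.exists_cost_le_of_mem_triggerEdge (k := k) h1.1
    rcases lexIncomparable_or (key S S' hS.1 (hS.2.trans hS'.2.symm) hne)
      (key S' S hS'.1 (hS'.2.trans hS.2.symm) hne.symm) with hl | hl
    · exact hF _ _ hl t (ht _ h1) (ht _ h2)
    · exact hF _ _ hl t (ht _ h2) (ht _ h1)
  -- Disjoint hyperedges are different because each contains its own centre.
  have hinj : Set.InjOn e I := by
    intro S hS S' hS' heq
    by_contra hne
    exact Set.disjoint_left.1 (hdisj S hS S' hS' hne) (hT.clause_mem_triggerEdge k _)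
      (heq ▸ hT.clause_mem_triggerEdge k _)
  have hcard : (e '' (I : Set (Finset ℕ))).encard = ((n + 1).choose j : ℕ) := by
    rw [hinj.encard_image, Set.encard_coe_eq_coe_finsetCard]
    simp [I]
  rw [← hcard]
  refine le_iSup₂_of_le (e '' (I : Set (Finset ℕ))) ⟨?_, ?_⟩ le_rfl
  · rintro _ ⟨S, hS, rfl⟩
    exact ⟨_, hT.clause_mem_primeImplicates _, rfl⟩
  · rintro _ ⟨S, hS, rfl⟩ _ ⟨S', hS', rfl⟩ hne
    exact hdisj S hS S' hS' fun h => hne (h ▸ rfl)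

end IsDopedTree

end Clauses

/-! ### Extremal trees -/

/-- The maximal number of leaves of a tree of Horton-Strahler number at most `k` and height at
most `h`. -/
def maxLeaves : ℕ → ℕ → ℕ
  | 0, _ => 1
  | _ + 1, 0 => 1
  | k + 1, h + 1 => maxLeaves k h + maxLeaves (k + 1) h

theorem maxLeaves_pos (k h : ℕ) : 0 < maxLeaves k h := by
  fun_induction maxLeaves k h <;> omega

/-- For Horton-Strahler bound `0` the value is constantly 1; positivity of the bound is what makes
optimal trees exhaust their height. -/
theorem maxLeaves_strictMono (k : ℕ) : StrictMono (maxLeaves (k + 1)) :=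
  strictMono_nat_of_lt_succ fun h => by
    simpa [maxLeaves] using maxLeaves_pos k h

theorem hortonStrahler_children {α : Type*} {v : α} {l r : BinaryTree α} {k : ℕ}
    (h : hortonStrahler (.node v l r) ≤ k) : ∃ j, k = j + 1 ∧
      (hortonStrahler l ≤ j ∧ hortonStrahler r ≤ j + 1 ∨
        hortonStrahler l ≤ j + 1 ∧ hortonStrahler r ≤ j) := by
  simp only [hortonStrahler] at h
  rcases k with _ | j
  · split_ifs at h <;> omega
  · exact ⟨j, rfl, by split_ifs at h <;> omega⟩

theorem numLeaves_le_maxLeaves {α : Type*} (T : BinaryTree α) (k h : ℕ)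
    (hk : hortonStrahler T ≤ k) (hh : T.height ≤ h) : T.numLeaves ≤ maxLeaves k h := by
  induction T generalizing k h with
  | nil => exact maxLeaves_pos k h
  | node v l r ihl ihr =>
    obtain ⟨j, rfl, hj⟩ := hortonStrahler_children hk
    rcases h with _ | h
    · simp at hh
    have hl : l.height ≤ h := by simp only [BinaryTree.height] at hh; omega
    have hr : r.height ≤ h := by simp only [BinaryTree.height] at hh; omega
    simp only [BinaryTree.numLeaves, maxLeaves]
    rcases hj with ⟨h1, h2⟩ | ⟨h1, h2⟩
    · exact add_le_add (ihl j h h1 hl) (ihr (j + 1) h h2 hr)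
    · rw [add_comm]
      exact add_le_add (ihr j h h2 hr) (ihl (j + 1) h h1 hl)

theorem exists_numLeaves_eq_maxLeaves (k h : ℕ) : ∃ T : BinaryTree Unit,
    hortonStrahler T ≤ k ∧ T.height ≤ h ∧ T.numLeaves = maxLeaves k h := by
  fun_induction maxLeaves k h with
  | case1 => exact ⟨.nil, by simp [hortonStrahler]⟩
  | case2 => exact ⟨.nil, by simp [hortonStrahler]⟩
  | case3 k h ih1 ih2 =>
    obtain ⟨l, hl1, hl2, hl3⟩ := ih1
    obtain ⟨r, hr1, hr2, hr3⟩ := ih2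
    refine ⟨.node () l r, ?_, ?_, by simp [hl3, hr3]⟩
    · simp only [hortonStrahler]
      split_ifs <;> omega
    · simp only [BinaryTree.height]
      omega

/-- An optimal tree has optimal subtrees, one of them with the Horton-Strahler bound lowered by 1.
For `j ≤ k` levels the bound stays positive, so strict monotonicity in the height forces the
remaining height to be attained. -/
theorem highAtDepth_of_numLeaves_eq {α : Type*} (j k h : ℕ) (T : BinaryTree α) (hjk : j ≤ k)
    (hjh : j ≤ h) (hT : hortonStrahler T ≤ k + 1) (hh : T.height ≤ h)
    (hl : T.numLeaves = maxLeaves (k + 1) h) : HighAtDepth (h - j) j T := by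
  induction j generalizing k h T with
  | zero =>
    have := numLeaves_le_maxLeaves T (k + 1) T.height hT le_rfl
    rw [hl] at this
    simpa [HighAtDepth] using (maxLeaves_strictMono k).le_iff_le.1 this
  | succ j ih =>
    obtain ⟨h, rfl⟩ : ∃ h', h = h' + 1 := ⟨h - 1, by omega⟩
    obtain ⟨k, rfl⟩ : ∃ k', k = k' + 1 := ⟨k - 1, by omega⟩
    obtain _ | ⟨v, l, r⟩ := T
    · have h1 := maxLeaves_pos (k + 1) h
      have h2 := maxLeaves_pos (k + 1 + 1) h
      rw [BinaryTree.numLeaves, maxLeaves] at hl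
      omega
    have hhl : l.height ≤ h := by simp only [BinaryTree.height] at hh; omega
    have hhr : r.height ≤ h := by simp only [BinaryTree.height] at hh; omega
    obtain ⟨i, hi, hc⟩ := hortonStrahler_children hT
    obtain rfl : i = k + 1 := by omega
    have hsum : l.numLeaves + r.numLeaves = maxLeaves (k + 1) h + maxLeaves (k + 1 + 1) h := by
      rw [BinaryTree.numLeaves] at hl
      rw [hl, maxLeaves]
    rw [Nat.add_sub_add_right]
    rcases hc with ⟨h1, h2⟩ | ⟨h1, h2⟩
    -- The two upper bounds add up to the attained total, so both are equalities.
    · have h3 := numLeaves_le_maxLeaves l _ h h1 hhl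
      have h4 := numLeaves_le_maxLeaves r (k + 1 + 1) h h2 hhr
      exact ⟨ih k h l (by omega) (by omega) h1 hhl (by omega),
        ih (k + 1) h r (by omega) (by omega) h2 hhr (by omega)⟩
    · have h3 := numLeaves_le_maxLeaves l (k + 1 + 1) h h1 hhl
      have h4 := numLeaves_le_maxLeaves r _ h h2 hhr
      exact ⟨ih (k + 1) h l (by omega) (by omega) h1 hhl (by omega),
        ih k h r (by omega) (by omega) h2 hhr (by omega)⟩

theorem IsExtremalTree.highAtDepth {α : Type*} {k h : ℕ} {T : BinaryTree α}
    (hT : IsExtremalTree (k + 1) h T) (hkh : k ≤ h) : HighAtDepth (h - k) k T := by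
  refine highAtDepth_of_numLeaves_eq k k h T le_rfl hkh hT.1.le hT.2.1.le
    (le_antisymm (numLeaves_le_maxLeaves T _ h hT.1.le hT.2.1.le) ?_)
  obtain ⟨T', h1, h2, h3⟩ := exists_numLeaves_eq_maxLeaves (k + 1) h
  have := hT.2.2 T' h1 h2
  -- All nodes number twice the leaves minus 1, so maximizing either is the same.
  simp only [numAllNodes, BinaryTree.numLeaves_eq_numNodes_succ] at this h3 ⊢
  omega

/-! ### Estimates of the middle binomial coefficient -/

/-- The quotient of the two sides is monotone in `j`, as `4 * j * (j + 1) ≤ (2 * j + 1) ^ 2`. At `j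
= 1` equality holds. -/
theorem sixteen_pow_lt_mul_choose_sq (j : ℕ) (hj : 2 ≤ j) :
    16 ^ j < 4 * j * (2 * j).choose j ^ 2 := by
  rw [← Nat.centralBinom_eq_two_mul_choose]
  induction j, hj using Nat.le_induction with
  | base => decide
  | succ j hj ih =>
    have h := Nat.succ_mul_centralBinom_succ j
    set a := j.centralBinom
    set b := (j + 1).centralBinom
    have h2 : (j + 1) * (4 * (j + 1) * b ^ 2) = 16 * (2 * j + 1) ^ 2 * a ^ 2 := by
      calc (j + 1) * (4 * (j + 1) * b ^ 2) = 4 * ((j + 1) * b) ^ 2 := by ring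
        _ = _ := by rw [h]; ring
    refine lt_of_mul_lt_mul_left ?_ (Nat.zero_le (j + 1))
    rw [h2]
    have h3 : (j + 1) * (4 * j) ≤ (2 * j + 1) ^ 2 := by nlinarith
    calc (j + 1) * 16 ^ (j + 1) = 16 * (j + 1) * 16 ^ j := by ring
      _ < 16 * (j + 1) * (4 * j * a ^ 2) := by gcongr
      _ = 16 * ((j + 1) * (4 * j)) * a ^ 2 := by ring
      _ ≤ _ := by gcongr

theorem four_mul_sixteen_pow_lt_mul_choose_sq (j : ℕ) (hj : 3 ≤ j) :
    4 * 16 ^ j < 2 * (2 * j + 1) * (2 * j + 1).choose j ^ 2 := by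
  induction j, hj using Nat.le_induction with
  | base => decide
  | succ j hj ih =>
    -- Recursion for the odd middle coefficients, the analogue of `Nat.succ_mul_centralBinom_succ`.
    have h : (j + 2) * (2 * (j + 1) + 1).choose (j + 1) =
        2 * (2 * j + 3) * (2 * j + 1).choose j := by
      have h1 := Nat.add_one_mul_choose_eq (2 * j + 2) (j + 1)
      have h2 := Nat.choose_succ_succ (2 * j + 1) j
      have h3 := Nat.choose_symm_half (j + 1)
      have h4 := Nat.choose_symm_half j
      rw [← h3, mul_comm, show 2 * (j + 1) + 1 = 2 * j + 2 + 1 by ring, ← h1, h2, h4]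
      ring
    set a := (2 * j + 1).choose j
    set b := (2 * (j + 1) + 1).choose (j + 1)
    refine lt_of_mul_lt_mul_left ?_ (Nat.zero_le ((j + 2) ^ 2))
    have h2 : (j + 2) ^ 2 * (2 * (2 * (j + 1) + 1) * b ^ 2) =
        8 * (2 * j + 3) ^ 3 * a ^ 2 := by
      calc (j + 2) ^ 2 * (2 * (2 * (j + 1) + 1) * b ^ 2)
          = 2 * (2 * j + 3) * ((j + 2) * b) ^ 2 := by ring
        _ = _ := by rw [h]; ring
    rw [h2]
    have h3 : 4 * (j + 2) ^ 2 * (2 * j + 1) ≤ (2 * j + 3) ^ 3 := by nlinarith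
    calc (j + 2) ^ 2 * (4 * 16 ^ (j + 1)) = 16 * (j + 2) ^ 2 * (4 * 16 ^ j) := by ring
      _ < 16 * (j + 2) ^ 2 * (2 * (2 * j + 1) * a ^ 2) := by gcongr
      _ = 8 * (4 * (j + 2) ^ 2 * (2 * j + 1)) * a ^ 2 := by ring
      _ ≤ _ := by gcongr

/-- The bound 6 is sharp: for `m = 5` the sides are 1024 and 1000. -/
theorem four_pow_lt_mul_choose_half_sq (m : ℕ) (hm : 6 ≤ m) :
    4 ^ m < 2 * m * m.choose (m / 2) ^ 2 := by
  obtain ⟨j, rfl | rfl⟩ := m.even_or_odd'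
  · rw [Nat.mul_div_cancel_left j two_pos, pow_mul, ← mul_assoc]
    exact sixteen_pow_lt_mul_choose_sq j (by omega)
  · rw [show (2 * j + 1) / 2 = j by omega, pow_succ, pow_mul, mul_comm]
    exact four_mul_sixteen_pow_lt_mul_choose_sq j (by omega)

theorem two_pow_div_sqrt_lt_choose_half (m : ℕ) (hm : 6 ≤ m) :
    1 / √2 * (2 ^ m / √(m : ℝ)) < (m.choose (m / 2) : ℝ) := by
  have hm0 : (0 : ℝ) < m := by exact_mod_cast (by omega : 0 < m)
  rw [div_mul_div_comm, one_mul, ← Real.sqrt_mul (by norm_num), div_lt_iff₀ (by positivity)]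
  refine lt_of_pow_lt_pow_left₀ 2 (by positivity) ?_
  rw [mul_pow, Real.sq_sqrt (by positivity), ← pow_mul, mul_comm m, pow_mul]
  have := four_pow_lt_mul_choose_half_sq m hm
  rw [mul_comm] at this
  norm_num
  exact_mod_cast this

/-- For `h ≥ 2 * k + 1` and `m = 1 + h - k`, the power `2 ^ m` is a constant multiple of `2 ^ h`,
and `h ≤ 2 * m ≤ 4 * h`. -/
theorem isTheta_two_pow_div_sqrt (k : ℕ) :
    (fun h : ℕ => 1 / √2 * ((2 : ℝ) ^ (1 + h - k) / √((1 + h - k : ℕ) : ℝ)))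
      =Θ[atTop] fun h : ℕ => (2 : ℝ) ^ h / √(h : ℝ) := by
  have hpow : ∀ h : ℕ, 2 * k + 1 ≤ h → (2 : ℝ) ^ (1 + h - k) = 2 / 2 ^ k * 2 ^ h := by
    intro h hh
    rw [div_mul_eq_mul_div, eq_div_iff (by positivity), ← pow_add, ← pow_succ']
    congr 1
    omega
  constructor
  · refine IsBigO.of_bound (2 / 2 ^ k) (eventually_atTop.2 ⟨2 * k + 1, fun h hh => ?_⟩)
    have h0 : (0 : ℝ) < h := by exact_mod_cast (by omega : 0 < h)
    have hle : (h : ℝ) ≤ 2 * ((1 + h - k : ℕ) : ℝ) := by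
      exact_mod_cast (by omega : h ≤ 2 * (1 + h - k))
    rw [Real.norm_of_nonneg (by positivity), Real.norm_of_nonneg (by positivity), hpow h hh,
      div_mul_div_comm, one_mul, ← Real.sqrt_mul (by norm_num), ← mul_div_assoc]
    gcongr
  · refine IsBigO.of_bound (2 ^ k) (eventually_atTop.2 ⟨2 * k + 1, fun h hh => ?_⟩)
    have h0 : (0 : ℝ) < h := by exact_mod_cast (by omega : 0 < h)
    have h1 : (0 : ℝ) < ((1 + h - k : ℕ) : ℝ) := by exact_mod_cast (by omega : 0 < 1 + h - k)
    have hle : 2 * ((1 + h - k : ℕ) : ℝ) ≤ 2 ^ 2 * h := by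
      exact_mod_cast (by omega : 2 * (1 + h - k) ≤ 2 ^ 2 * h)
    rw [Real.norm_of_nonneg (by positivity), Real.norm_of_nonneg (by positivity), hpow h hh,
      div_mul_div_comm, one_mul, ← Real.sqrt_mul (by norm_num)]
    have hs : √(2 * ((1 + h - k : ℕ) : ℝ)) ≤ 2 * √(h : ℝ) := by
      calc _ ≤ √(2 ^ 2 * (h : ℝ)) := Real.sqrt_le_sqrt hle
        _ = _ := by rw [Real.sqrt_mul (by norm_num), Real.sqrt_sq (by norm_num)]
    calc (2 : ℝ) ^ h / √(h : ℝ) = 2 * 2 ^ h / (2 * √(h : ℝ)) := by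
          rw [mul_div_mul_left _ _ (by norm_num)]
      _ ≤ 2 * 2 ^ h / √(2 * ((1 + h - k : ℕ) : ℝ)) := by gcongr
      _ = _ := by field_simp

theorem theorem6p5 {VA : Type*} [DecidableEq VA] [Infinite VA] (k : ℕ) :
    (∀ (h : ℕ), k + 1 ≤ h →
      ∀ T : BinaryTree VA, InjectivelyLabelled T → IsExtremalTree (k + 1) h T →
      ∀ u : Finset (Lit VA) → VA, IsDopingAssignment u (smuOne T) →
        (((1 + h - k).choose ((1 + h - k) / 2) : ℕ) : ℕ∞) ≤
          matchingNumber (triggerHypergraph (doping u (smuOne T)) k)) ∧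
    (∀ (h : ℕ), k + 5 ≤ h →
      (1 / Real.sqrt 2) * ((2 : ℝ) ^ (1 + h - k) / Real.sqrt ((1 + h - k : ℕ) : ℝ)) <
        ((1 + h - k).choose ((1 + h - k) / 2) : ℝ)) ∧
    (fun h : ℕ => (1 / Real.sqrt 2) *
        ((2 : ℝ) ^ (1 + h - k) / Real.sqrt ((1 + h - k : ℕ) : ℝ)))
      =Θ[atTop] (fun h : ℕ => (2 : ℝ) ^ h / Real.sqrt (h : ℝ)) := by
  refine ⟨fun h hh T hlab hext u hu => ?_,
    fun h hh => two_pow_div_sqrt_lt_choose_half _ (by omega), isTheta_two_pow_div_sqrt k⟩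
  rw [show 1 + h - k = h - k + 1 by omega]
  exact IsDopedTree.choose_le_matchingNumber ⟨hlab, hu⟩ _
    (hext.highAtDepth (by omega))
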